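/- Let $G$ be a finite connected bipartite graph without multiple edges, with color classes $E$ and $V$ and at least one edge, and put $d=|E|+|V|-2$. Let $Q_G\subset\mathbf R^E\oplus\mathbf R^V$ be its root polytope, that is, the convex hull of the vectors $\mathbf i_{e}+\mathbf i_{v}$ for all edges $ev$ of $G$ ($e\in E$, $v\in V$), where $\mathbf i_x$ denotes the standard basis vector indexed by $x$. For $s\in\mathbf N=\{0,1,2,\dots\}$ let $\varepsilon_G(s)=\left|(s\cdot Q_G)\cap(\mathbf Z^E\oplus\mathbf Z^V)\right|$ be the Ehrhart polynomial of $Q_G$. There are unique rational numbers $a_0,\dots,a_d$ such that \[\varepsilon_G(s)=\sum_{k=0}^{d}a_k\binom{s+d-k}{d}\qquad\text{for all } s\in\mathbf N.\] A triangulation of $Q_G$ is a collection of maximal (that is, of the same dimension as $Q_G$) simplices, each spanned by vertices of $Q_G$, such that each two intersect in a common (possibly empty) face and their union is $Q_G$. If the simplicial complex consisting of these simplices and all their faces has dimension $\delta$ and exactly $f_k$ simplices of dimension $k$ for $0\le k\le\delta$, then its $f$-vector is the polynomial $f(y)=y^{\delta+1}+f_0y^{\delta}+f_1y^{\delta-1}+\cdots+f_{\delta}$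 and its $h$-vector is the polynomial $h(x)=f(x-1)$. Then the $h$-vector $h$ of any triangulation of $Q_G$ satisfies \[x^{d+1}\,h(x^{-1})=a_0+a_1x+a_2x^2+\cdots+a_dx^d.\] In particular, all triangulations of $Q_G$ share the same $h$-vector. -/

import Mathlib

open scoped Pointwise

noncomputable section

namespace RootPolytope

section Triangulations

variable {W : Type*} [AddCommGroup W] [Module ℝ W]

/-- A triangulation of a polytope `Q`, given as a finite collection `T` of maximal simplices,
each encoded by its finite set of vertices. -/
structure IsTriangulation (Q : Set W) (T : Finset (Finset W)) : Prop where
  /-- the simplices are spanned by vertices of `Q` -/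
  subset_vertices : ∀ s ∈ T, (s : Set W) ⊆ Q.extremePoints ℝ
  /-- they are simplices -/
  affineIndependent : ∀ s ∈ T, AffineIndependent ℝ ((↑) : s → W)
  /-- they are maximal, that is, of the same dimension as `Q` -/
  affineSpan_eq : ∀ s ∈ T, affineSpan ℝ (s : Set W) = affineSpan ℝ Q
  /-- each two of them intersect in a common (possibly empty) face -/
  inter_face : ∀ s ∈ T, ∀ t ∈ T, ∃ u : Finset W, u ⊆ s ∧ u ⊆ t ∧
    convexHull ℝ (s : Set W) ∩ convexHull ℝ (t : Set W) = convexHull ℝ (u : Set W)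
  /-- their union is `Q` -/
  union_eq : ⋃ s ∈ T, convexHull ℝ (s : Set W) = Q

/-- The dimension of the simplicial complex generated by `T`. -/
def complexDim (T : Finset (Finset W)) : ℕ := T.sup Finset.card - 1

/-- The number `f_k` of `k`-dimensional simplices in the simplicial complex formed by the members
of `T` and all their faces. -/
def faceCount (T : Finset (Finset W)) (k : ℕ) : ℕ :=
  {u : Finset W | u.card = k + 1 ∧ ∃ s ∈ T, u ⊆ s}.ncard

/-- The `f`-vector `f(y) = y^{d+1} + f_0 y^d + f_1 y^{d-1} + ⋯ + f_d`, where `d` is the dimension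
of the complex. -/
def fVector (T : Finset (Finset W)) : Polynomial ℚ :=
  Polynomial.X ^ (complexDim T + 1) +
    ∑ k ∈ Finset.range (complexDim T + 1),
      Polynomial.C (faceCount T k : ℚ) * Polynomial.X ^ (complexDim T - k)

/-- The `h`-vector `h(x) = f(x - 1)`. -/
def hVector (T : Finset (Finset W)) : Polynomial ℚ :=
  (fVector T).comp (Polynomial.X - 1)

end Triangulations

section Graph

variable {E V : Type*} [DecidableEq E] [DecidableEq V]

/-- The root polytope of a bipartite graph with color classes `E` and `V`: the convex hull in
`ℝ^E ⊕ ℝ^V` of the vectors `i_e + i_v` for all edges `ev`. -/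
def rootPolytope (G : SimpleGraph (E ⊕ V)) : Set (E ⊕ V → ℝ) :=
  convexHull ℝ {p | ∃ (e : E) (v : V), G.Adj (Sum.inl e) (Sum.inr v) ∧
    p = Pi.single (Sum.inl e) 1 + Pi.single (Sum.inr v) 1}

/-- `ε_G(s)`, the number of lattice points in `s · Q_G`. -/
def ehrhart (G : SimpleGraph (E ⊕ V)) (s : ℕ) : ℕ :=
  {x : E ⊕ V → ℝ | x ∈ (s : ℝ) • rootPolytope G ∧ ∀ i, ∃ z : ℤ, x i = z}.ncard

/-- `a_0, …, a_d` are the coefficients of `ε_G` with respect to the binomial coefficients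
`C_k(s) = (s+d-k choose d)`. (Here `k ≤ d`, so the subtraction is never truncated.) -/
def IsEhrhartExpansion (G : SimpleGraph (E ⊕ V)) (d : ℕ) (a : Fin (d + 1) → ℚ) : Prop :=
  ∀ s : ℕ, (ehrhart G s : ℚ) = ∑ k : Fin (d + 1), a k * ((s + d - (k : ℕ)).choose d : ℚ)

end Graph

end RootPolytope

end

/-! The argument compares two formulas for the Ehrhart series of $Q_G$. Edge vectors of a bipartite
graph are unimodular: a linearly independent set of them is a forest, and stripping leaves shows
that a lattice point in its span has integer coefficients (`exists_int_coeff`). Hence lattice points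
of $(s+1)Q_G$ over the relative interior of a $k$-simplex correspond to compositions of $s+1$ into
$k+1$ positive parts, so there are $\binom{s}{k}$ of them. Each point of $Q_G$ is interior to
exactly one face of a triangulation, so $\varepsilon_G(s+1)=\sum_k f_k\binom{s}{k}$, which gives
$(1-x)^{d+1}\sum_s\varepsilon_G(s)x^s=(1-x)^{d+1}+\sum_k f_kx^{k+1}(1-x)^{d-k}=x^{d+1}h(x^{-1})$.
Since $\binom{s+d-k}{d}$ has generating function $x^k/(1-x)^{d+1}$, the left side is also $\sum_k
a_kx^k$.

Existence of the $a_k$ needs the numerator to have degree at most $d$, and it must not presuppose a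
triangulation. Both are handled by `lexComplex`, the supports of lexicographically maximal convex
representations. It is a cone, and pairing its faces with and without the apex turns the count into
$\sum_F\binom{s}{|F|}$ with $|F|\le d$. -/

namespace RootPolytope

/-! ### Generating functions and binomial expansions -/

section GeneratingFunctions

open PowerSeries

theorem mk_choose_mul_one_sub_pow {k d : ℕ} (hk : k ≤ d) :
    (mk fun s => ((s + d - k).choose d : ℚ)) * (1 - X) ^ (d + 1) = X ^ k := by
  have h : (mk fun s => ((s + d - k).choose d : ℚ)) =
      X ^ k * mk fun s => ((d + s).choose d : ℚ) := by
    ext s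
    rw [coeff_X_pow_mul']
    split_ifs with hs
    · simp only [coeff_mk]
      congr 2
      omega
    -- As `k ≤ d`, the subtraction is exact, and for `s < k` the upper entry drops below `d`.
    · rw [coeff_mk, Nat.choose_eq_zero_of_lt (by omega), Nat.cast_zero]
  rw [h, mul_assoc, mk_add_choose_mul_one_sub_pow_eq_one, mul_one]

theorem one_sub_X_pow_ne_zero (n : ℕ) : (1 - X : ℚ⟦X⟧) ^ n ≠ 0 := by
  apply pow_ne_zero
  intro h
  have := congrArg constantCoeff h
  simp at this

/-- Expanding a sequence in the polynomials `C(s + d - k, d)` amounts to writing its generating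
function with denominator `(1 - X) ^ (d + 1)`. -/
theorem expansion_iff (f : ℕ → ℚ) (d : ℕ) (a : Fin (d + 1) → ℚ) :
    (∀ s : ℕ, f s = ∑ k : Fin (d + 1), a k * ((s + d - (k : ℕ)).choose d : ℚ)) ↔
      mk f * (1 - X) ^ (d + 1) =
        ((∑ k : Fin (d + 1), Polynomial.C (a k) * Polynomial.X ^ (k : ℕ) : Polynomial ℚ) :
          ℚ⟦X⟧) := by
  have h : ((∑ k : Fin (d + 1), Polynomial.C (a k) * Polynomial.X ^ (k : ℕ) : Polynomial ℚ) :
          ℚ⟦X⟧) = (mk fun s => ∑ k : Fin (d + 1), a k * ((s + d - (k : ℕ)).choose d : ℚ)) *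
            (1 - X) ^ (d + 1) := by
    have h' : (mk fun s => ∑ k : Fin (d + 1), a k * ((s + d - (k : ℕ)).choose d : ℚ)) =
        ∑ k : Fin (d + 1), C (a k) * mk fun s => ((s + d - (k : ℕ)).choose d : ℚ) := by
      ext s
      simp [coeff_C_mul]
    rw [h', Finset.sum_mul, ← Polynomial.coeToPowerSeries.ringHom_apply, map_sum]
    refine Finset.sum_congr rfl fun k _ => ?_
    rw [mul_assoc, mk_choose_mul_one_sub_pow (Nat.lt_succ_iff.1 k.2)]
    simp
  rw [h, mul_left_inj' (one_sub_X_pow_ne_zero _), PowerSeries.ext_iff]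
  simp

theorem expansion_unique {f : ℕ → ℚ} {d : ℕ} {a b : Fin (d + 1) → ℚ}
    (ha : ∀ s : ℕ, f s = ∑ k : Fin (d + 1), a k * ((s + d - (k : ℕ)).choose d : ℚ))
    (hb : ∀ s : ℕ, f s = ∑ k : Fin (d + 1), b k * ((s + d - (k : ℕ)).choose d : ℚ)) : a = b := by
  rw [expansion_iff] at ha hb
  have h := Polynomial.coe_injective ℚ (ha.symm.trans hb)
  funext j
  have hj := congrArg (fun p => p.coeff (j : ℕ)) h
  simpa [Polynomial.finsetSum_coeff, Polynomial.coeff_X_pow, Fin.val_inj] using hj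

theorem exists_expansion {f : ℕ → ℚ} {d : ℕ} (p : Polynomial ℚ) (hp : p.natDegree < d + 1)
    (h : mk f * (1 - X) ^ (d + 1) = (p : ℚ⟦X⟧)) :
    ∃ a : Fin (d + 1) → ℚ,
      ∀ s : ℕ, f s = ∑ k : Fin (d + 1), a k * ((s + d - (k : ℕ)).choose d : ℚ) := by
  refine ⟨fun k => p.coeff k, ?_⟩
  rw [expansion_iff, h]
  conv_lhs => rw [p.as_sum_range_C_mul_X_pow' hp]
  rw [← Fin.sum_univ_eq_sum_range (fun i => Polynomial.C (p.coeff i) * Polynomial.X ^ i)]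

/-- Linear combinations of the polynomials `C(s, k)`, `k ≤ d`, have an expansion. -/
theorem exists_expansion_sum_choose {ι : Type*} (D : Finset ι) (r : ι → ℕ) {d : ℕ}
    (hr : ∀ i ∈ D, r i ≤ d) :
    ∃ a : Fin (d + 1) → ℚ, ∀ s : ℕ, (∑ i ∈ D, (s.choose (r i) : ℚ)) =
      ∑ k : Fin (d + 1), a k * ((s + d - (k : ℕ)).choose d : ℚ) := by
  -- $\binom{s}{r}$ has generating function $X^r/(1-X)^{r+1}$; over the denominator $(1-X)^{d+1}$
  -- its numerator has degree at most $d$.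
  refine exists_expansion
    (∑ i ∈ D, Polynomial.X ^ (r i) * (1 - Polynomial.X) ^ (d - r i)) ?_ ?_
  · refine Nat.lt_succ_of_le (Polynomial.natDegree_sum_le_of_forall_le _ _ fun i hi => ?_)
    have h1 : (1 - Polynomial.X : Polynomial ℚ).natDegree ≤ 1 := by
      compute_degree
    calc _ ≤ r i + (d - r i) * 1 := Polynomial.natDegree_mul_le_of_le
            (Polynomial.natDegree_X_pow_le _) (Polynomial.natDegree_pow_le_of_le _ h1)
      _ = d := by have := hr i hi; omega
  · have h' : (mk fun s => ∑ i ∈ D, (s.choose (r i) : ℚ)) =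
        ∑ i ∈ D, mk fun s => ((s + r i - r i).choose (r i) : ℚ) := by
      ext s
      simp
    rw [h', Finset.sum_mul, ← Polynomial.coeToPowerSeries.ringHom_apply, map_sum]
    refine Finset.sum_congr rfl fun i hi => ?_
    have hd : d + 1 = (r i + 1) + (d - r i) := by have := hr i hi; omega
    rw [hd, pow_add, ← mul_assoc, mk_choose_mul_one_sub_pow le_rfl]
    simp

/-- The generating function of a sequence counted by the faces of a simplicial complex. -/
theorem mk_mul_one_sub_pow_of_faces {f : ℕ → ℚ} {d : ℕ} (F : ℕ → ℚ) (h0 : f 0 = 1)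
    (hf : ∀ s : ℕ, f (s + 1) = ∑ k ∈ Finset.range (d + 1), F k * (s.choose k : ℚ)) :
    mk f * (1 - X) ^ (d + 1) =
      (((1 - Polynomial.X) ^ (d + 1) + ∑ k ∈ Finset.range (d + 1),
        Polynomial.C (F k) * (Polynomial.X ^ (k + 1) * (1 - Polynomial.X) ^ (d - k)) :
          Polynomial ℚ) : ℚ⟦X⟧) := by
  -- The summand `1` is the value at `0`, and the factor `X` accounts for the shift from `s` to `s +
  -- 1`.
  have h' : mk f = 1 + ∑ k ∈ Finset.range (d + 1),
      C (F k) * (X * mk fun s => ((s + k - k).choose k : ℚ)) := by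
    ext s
    cases s with
    | zero => simp [h0]
    | succ s => simp [hf, coeff_C_mul, coeff_succ_X_mul, coeff_one]
  rw [h', add_mul, one_mul, Finset.sum_mul, ← Polynomial.coeToPowerSeries.ringHom_apply,
    map_add, map_sum]
  congr 1
  · simp
  refine Finset.sum_congr rfl fun k hk => ?_
  have hd : d + 1 = (k + 1) + (d - k) := by have := Finset.mem_range.1 hk; omega
  rw [hd, pow_add, mul_assoc, ← mul_assoc (X * _), mul_assoc X,
    mk_choose_mul_one_sub_pow le_rfl]
  simp [pow_succ']

end GeneratingFunctions

/-! ### Unimodularity of edge vectors -/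

section EdgeVectors

variable {E V : Type*} [DecidableEq E] [DecidableEq V]

/-- The vectors `i_e + i_v` for the edges `ev` of `G`. -/
def edgeVectors (G : SimpleGraph (E ⊕ V)) : Set (E ⊕ V → ℝ) :=
  {p | ∃ (e : E) (v : V), G.Adj (Sum.inl e) (Sum.inr v) ∧
    p = Pi.single (Sum.inl e) 1 + Pi.single (Sum.inr v) 1}

theorem rootPolytope_eq (G : SimpleGraph (E ⊕ V)) :
    rootPolytope G = convexHull ℝ (edgeVectors G) := rfl

theorem edgeVectors_finite [Finite E] [Finite V] (G : SimpleGraph (E ⊕ V)) :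
    (edgeVectors G).Finite := by
  refine (Set.finite_range fun p : E × V =>
    (Pi.single (Sum.inl p.1) 1 + Pi.single (Sum.inr p.2) 1 : E ⊕ V → ℝ)).subset ?_
  rintro _ ⟨e, v, -, rfl⟩
  exact ⟨(e, v), rfl⟩

variable {G : SimpleGraph (E ⊕ V)} {a : E ⊕ V → ℝ}

theorem edgeVectors_apply (ha : a ∈ edgeVectors G) (i : E ⊕ V) : a i = 0 ∨ a i = 1 := by
  obtain ⟨e, v, -, rfl⟩ := ha
  rcases i with i | i <;> simp [Pi.single_apply] <;> tauto

theorem edgeVectors_sum_inl [Fintype E] (ha : a ∈ edgeVectors G) : ∑ e, a (Sum.inl e) = 1 := by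
  obtain ⟨e, v, -, rfl⟩ := ha
  simp [Pi.single_apply]

theorem edgeVectors_sum_inr [Fintype V] (ha : a ∈ edgeVectors G) : ∑ v, a (Sum.inr v) = 1 := by
  obtain ⟨e, v, -, rfl⟩ := ha
  simp [Pi.single_apply]

variable [Fintype E] [Fintype V]

theorem edgeVectors_sum (ha : a ∈ edgeVectors G) : ∑ i, a i = 2 := by
  rw [Fintype.sum_sum_type, edgeVectors_sum_inl ha, edgeVectors_sum_inr ha]
  norm_num

/-- Linearly independent edge vectors that are supported on `S` number less than `S`. -/
theorem card_lt_of_linearIndepOn {F : Finset (E ⊕ V → ℝ)} (hFA : ↑F ⊆ edgeVectors G)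
    (hF : LinearIndepOn ℝ id (F : Set (E ⊕ V → ℝ))) {S : Finset (E ⊕ V)} {i₀ : E ⊕ V}
    (hi₀ : i₀ ∈ S) (hS : ∀ a ∈ F, ∀ i ∉ S, a i = 0) : F.card < S.card := by
  -- The coordinate `i₀` can be dropped: in any combination of edge vectors the coordinates have the
  -- same sum over each color class, so if all others vanish then so does the one at `i₀`.
  have hli : LinearIndependent ℝ
      (fun (a : F) (i : S.erase i₀) => a.1 i.1) := by
    rw [Fintype.linearIndependent_iff]
    intro g hg
    have hF' : LinearIndependent ℝ (fun a : F => (a : E ⊕ V → ℝ)) := hF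
    refine Fintype.linearIndependent_iff.1 hF' g ?_
    set y : E ⊕ V → ℝ := ∑ a : F, g a • (a : E ⊕ V → ℝ) with hy
    have hyi : ∀ i, y i = ∑ a : F, g a * (a : E ⊕ V → ℝ) i := fun i => by simp [hy]
    have h1 : ∀ i, i ≠ i₀ → y i = 0 := by
      intro i hi
      by_cases hiS : i ∈ S
      · have := congrFun hg ⟨i, Finset.mem_erase.2 ⟨hi, hiS⟩⟩
        simpa [hyi] using this
      · rw [hyi]
        exact Finset.sum_eq_zero fun a _ => by rw [hS a a.2 i hiS, mul_zero]
    have h2 : ∑ e, y (Sum.inl e) = ∑ v, y (Sum.inr v) := by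
      simp only [hyi]
      rw [Finset.sum_comm, Finset.sum_comm (s := (Finset.univ : Finset V))]
      refine Finset.sum_congr rfl fun a _ => ?_
      rw [← Finset.mul_sum, ← Finset.mul_sum, edgeVectors_sum_inl (hFA a.2),
        edgeVectors_sum_inr (hFA a.2)]
    have h3 : y i₀ = 0 := by
      rcases i₀ with e₀ | v₀
      · rw [Finset.sum_eq_single e₀ (fun e _ he => h1 _ (by simpa using he)) (by simp),
          Finset.sum_eq_zero (fun v _ => h1 _ (by simp))] at h2
        exact h2
      · rw [Finset.sum_eq_single (s := (Finset.univ : Finset V)) v₀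
          (fun e _ he => h1 _ (by simpa using he)) (by simp),
          Finset.sum_eq_zero (fun v _ => h1 _ (by simp))] at h2
        exact h2.symm
    funext i
    by_cases hi : i = i₀
    · rw [hi, h3, Pi.zero_apply]
    · exact h1 i hi
  have := hli.fintype_card_le_finrank
  simp only [Fintype.card_coe, Module.finrank_fintype_fun_eq_card, Finset.card_erase_of_mem hi₀]
    at this
  have := Finset.card_pos.2 ⟨i₀, hi₀⟩
  omega

/-- A nonempty linearly independent set of edge vectors (a forest) has a leaf. -/
theorem exists_leaf {F : Finset (E ⊕ V → ℝ)} (hFA : ↑F ⊆ edgeVectors G)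
    (hF : LinearIndepOn ℝ id (F : Set (E ⊕ V → ℝ))) (hne : F.Nonempty) :
    ∃ a ∈ F, ∃ i, a i = 1 ∧ ∀ b ∈ F, b ≠ a → b i = 0 := by
  classical
  by_contra! hcon
  -- Double counting: without a leaf every vertex covered by `F` has degree at least two, so `2|S| ≤
  -- 2|F|`, against `|F| < |S|`.
  set S : Finset (E ⊕ V) := Finset.univ.filter fun i => ∃ a ∈ F, a i ≠ 0 with hS
  have hnn : ∀ a ∈ F, ∀ i, 0 ≤ a i := fun a ha i => by
    rcases edgeVectors_apply (hFA ha) i with h | h <;> simp [h]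
  have h2 : ∀ i ∈ S, (2 : ℝ) ≤ ∑ a ∈ F, a i := by
    intro i hi
    obtain ⟨a, ha, hai⟩ := (Finset.mem_filter.1 hi).2
    have hai := (edgeVectors_apply (hFA ha) i).resolve_left hai
    obtain ⟨b, hb, hba, hbi⟩ := hcon a ha i hai
    have hbi := (edgeVectors_apply (hFA hb) i).resolve_left hbi
    calc (2 : ℝ) = ∑ x ∈ {a, b}, x i := by
          rw [Finset.sum_pair hba.symm, hai, hbi]; norm_num
      _ ≤ _ := Finset.sum_le_sum_of_subset_of_nonneg
          (by intro x; simp; rintro (rfl | rfl) <;> assumption) (fun x hx _ => hnn x hx i)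
  have hlt : F.card < S.card := by
    obtain ⟨a, ha⟩ := hne
    have : ∃ i, a i ≠ 0 := by
      by_contra! h
      have := edgeVectors_sum (hFA ha)
      simp [h] at this
    obtain ⟨i, hi⟩ := this
    refine card_lt_of_linearIndepOn hFA hF (i₀ := i) (by simp [hS]; exact ⟨a, ha, hi⟩) ?_
    intro b hb j hj
    by_contra h
    exact hj (Finset.mem_filter.2 ⟨Finset.mem_univ _, b, hb, h⟩)
  have h3 : (S.card : ℝ) * 2 ≤ F.card * 2 := by
    calc (S.card : ℝ) * 2 = ∑ i ∈ S, 2 := by simp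
      _ ≤ ∑ i ∈ S, ∑ a ∈ F, a i := Finset.sum_le_sum h2
      _ ≤ ∑ i, ∑ a ∈ F, a i := Finset.sum_le_sum_of_subset_of_nonneg (Finset.subset_univ _)
          (fun i _ _ => Finset.sum_nonneg fun a ha => hnn a ha i)
      _ = ∑ a ∈ F, ∑ i, a i := Finset.sum_comm
      _ = ∑ a ∈ F, 2 := Finset.sum_congr rfl fun a ha => edgeVectors_sum (hFA ha)
      _ = F.card * 2 := by simp
  have h4 : (F.card : ℝ) < S.card := by exact_mod_cast hlt
  linarith

/-- Unimodularity: the coefficients of a lattice point with respect to linearly independent edge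
vectors are integers. -/
theorem exists_int_coeff (n : ℕ) : ∀ {F : Finset (E ⊕ V → ℝ)}, F.card = n →
    ↑F ⊆ edgeVectors G → LinearIndepOn ℝ id (F : Set (E ⊕ V → ℝ)) → ∀ c : (E ⊕ V → ℝ) → ℝ,
    (∀ i, ∃ z : ℤ, ∑ a ∈ F, c a * a i = z) → ∀ a ∈ F, ∃ z : ℤ, c a = z := by
  classical
  induction n with
  | zero =>
    intro F h _ _ c _ a ha
    rw [Finset.card_eq_zero.1 h] at ha
    simp at ha
  | succ n ih =>
    intro F h hFA hF c hc
    obtain ⟨a, ha, i, hai, hi⟩ := exists_leaf hFA hF (Finset.card_pos.1 (by omega))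
    -- At the leaf `i` the coordinate of the sum is `c a` alone. Removing `a` then changes every
    -- coordinate by an integer.
    have hca : ∃ z : ℤ, c a = z := by
      obtain ⟨z, hz⟩ := hc i
      refine ⟨z, ?_⟩
      rw [← hz, Finset.sum_eq_single a (fun b hb hba => by rw [hi b hb hba, mul_zero])
        (fun h => absurd ha h), hai, mul_one]
    have hsub : F.erase a ⊆ F := Finset.erase_subset _ _
    have := ih (F := F.erase a) (by rw [Finset.card_erase_of_mem ha]; omega)
      (subset_trans (Finset.coe_subset.2 hsub) hFA) (hF.mono (Finset.coe_subset.2 hsub)) c (by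
        intro j
        obtain ⟨z, hz⟩ := hc j
        obtain ⟨w, hw⟩ := hca
        rw [← Finset.add_sum_erase F _ ha] at hz
        rcases edgeVectors_apply (hFA ha) j with h | h
        · exact ⟨z, by rw [← hz, h]; ring⟩
        · exact ⟨z - w, by push_cast; rw [← hz, ← hw, h]; ring⟩)
    intro b hb
    by_cases hba : b = a
    · rwa [hba]
    · exact this b (Finset.mem_erase.2 ⟨hba, hb⟩)

end EdgeVectors

/-! ### Counting compositions into positive parts -/

section Compositions

variable {W : Type*} [DecidableEq W]

/-- The compositions of `n` into positive parts indexed by `F`. -/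
def positiveCompositions (F : Finset W) (n : ℕ) : Finset (W →₀ ℕ) :=
  (F.finsuppAntidiag n).filter fun m => ∀ a ∈ F, 0 < m a

theorem mem_positiveCompositions {F : Finset W} {n : ℕ} {m : W →₀ ℕ} :
    m ∈ positiveCompositions F n ↔
      (F.sum m = n ∧ m.support ⊆ F) ∧ ∀ a ∈ F, 0 < m a := by
  rw [positiveCompositions, Finset.mem_filter, Finset.mem_finsuppAntidiag]

theorem card_positiveCompositions_empty (n : ℕ) :
    (positiveCompositions (∅ : Finset W) (n + 1)).card = 0 := by
  rw [Finset.card_eq_zero, Finset.eq_empty_iff_forall_notMem]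
  intro m hm
  have := (mem_positiveCompositions.1 hm).1.1
  simp at this

/-- Subtracting one from each part reduces this to weak compositions of `n + 1 - F.card`. -/
theorem card_positiveCompositions {F : Finset W} (hF : F.Nonempty) (n : ℕ) :
    (positiveCompositions F (n + 1)).card = n.choose (F.card - 1) := by
  have hpos := hF.card_pos
  rcases le_or_gt F.card (n + 1) with hle | hlt
  · set u : W →₀ ℕ := Finsupp.indicator F fun _ _ => 1 with hu
    have hu1 : ∀ a ∈ F, u a = 1 := fun a ha => by simp [hu, Finsupp.indicator_apply, ha]
    have hu0 : ∀ a ∉ F, u a = 0 := fun a ha => by simp [hu, Finsupp.indicator_apply, ha]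
    have hsum : F.sum u = F.card := by
      rw [Finset.sum_congr rfl hu1]; simp
    have himage : positiveCompositions F (n + 1) =
        (F.finsuppAntidiag (n + 1 - F.card)).image (· + u) := by
      ext m
      rw [mem_positiveCompositions, Finset.mem_image]
      constructor
      · rintro ⟨⟨h1, h2⟩, h3⟩
        have hum : u ≤ m := by
          intro a
          by_cases ha : a ∈ F
          · rw [hu1 a ha]; exact h3 a ha
          · rw [hu0 a ha]; exact Nat.zero_le _
        refine ⟨m - u, ?_, tsub_add_cancel_of_le hum⟩
        rw [Finset.mem_finsuppAntidiag]
        constructor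
        · have h4 : F.sum (m - u) + F.sum u = F.sum m := by
            rw [← Finset.sum_add_distrib]
            exact Finset.sum_congr rfl fun a _ => tsub_add_cancel_of_le (hum a)
          omega
        · exact (Finsupp.support_tsub).trans h2
      · rintro ⟨m', hm', rfl⟩
        rw [Finset.mem_finsuppAntidiag] at hm'
        refine ⟨⟨?_, ?_⟩, ?_⟩
        · simp only [Finsupp.coe_add, Pi.add_apply, Finset.sum_add_distrib, hsum, hm'.1]
          omega
        · intro a ha
          by_contra haF
          have h1 : m' a = 0 := by
            by_contra h
            exact haF (hm'.2 (Finsupp.mem_support_iff.2 h))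
          simp [h1, hu0 a haF] at ha
        · intro a ha
          simp [hu1 a ha]
    rw [himage, Finset.card_image_of_injective _ (add_left_injective u),
      Finset.card_finsuppAntidiag_nat_eq_choose]
    have h1 : F.card + (n + 1 - F.card) - 1 = n := by omega
    rw [h1, ← Nat.choose_symm (by omega : n + 1 - F.card ≤ n)]
    congr 1
    omega
  · rw [Nat.choose_eq_zero_of_lt (by omega), Finset.card_eq_zero,
      Finset.eq_empty_iff_forall_notMem]
    intro m hm
    rw [mem_positiveCompositions] at hm
    have : F.card ≤ F.sum m := by
      calc F.card = ∑ _a ∈ F, 1 := by simp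
        _ ≤ _ := Finset.sum_le_sum fun a ha => hm.2 a ha
    omega

end Compositions

/-! ### Unique representation by open simplices -/

section RepresentationComplex

variable {W : Type*} [AddCommGroup W] [Module ℝ W]

/-- A family of linearly independent subsets of `A` such that every point of the convex hull of `A`
lies in the relative interior of the simplex spanned by exactly one of them. -/
structure IsRepresentationComplex (A : Set W) (D : Finset (Finset W)) : Prop where
  subset : ∀ F ∈ D, (F : Set W) ⊆ A
  linearIndepOn : ∀ F ∈ D, LinearIndepOn ℝ id (F : Set W)
  exists_rep : ∀ q ∈ convexHull ℝ A, ∃ F ∈ D, ∃ c : W → ℝ, (∀ a ∈ F, 0 < c a) ∧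
    ∑ a ∈ F, c a = 1 ∧ ∑ a ∈ F, c a • a = q
  unique : ∀ F ∈ D, ∀ F' ∈ D, ∀ c c' : W → ℝ, (∀ a ∈ F, 0 < c a) → (∀ a ∈ F', 0 < c' a) →
    ∑ a ∈ F, c a = 1 → ∑ a ∈ F', c' a = 1 →
    ∑ a ∈ F, c a • a = ∑ a ∈ F', c' a • a → F = F'

end RepresentationComplex

/-! ### Lattice points in dilates -/

section Count

variable {E V : Type*} [DecidableEq E] [DecidableEq V] {G : SimpleGraph (E ⊕ V)}

theorem ehrhart_zero (hG : (edgeVectors G).Nonempty) : ehrhart G 0 = 1 := by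
  have : {x : E ⊕ V → ℝ | x ∈ ((0 : ℕ) : ℝ) • rootPolytope G ∧ ∀ i, ∃ z : ℤ, x i = z} = {0} := by
    rw [rootPolytope_eq, Nat.cast_zero, Set.zero_smul_set hG.convexHull]
    ext x
    simp only [Set.mem_zero, Set.mem_ofPred_eq, Set.mem_singleton_iff]
    constructor
    · exact fun h => h.1
    · rintro rfl
      exact ⟨rfl, fun i => ⟨0, by simp⟩⟩
  rw [ehrhart, this, Set.ncard_singleton]

variable [Fintype E] [Fintype V]

/-- The lattice points of a positive dilate of the root polytope, listed by the relative interiors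
of the simplices of a representation complex. -/
theorem latticePoints_eq {D : Finset (Finset (E ⊕ V → ℝ))}
    (hD : IsRepresentationComplex (edgeVectors G) D) (s : ℕ) :
    {x : E ⊕ V → ℝ | x ∈ ((s + 1 : ℕ) : ℝ) • rootPolytope G ∧ ∀ i, ∃ z : ℤ, x i = z} =
      {x | ∃ F ∈ D, ∃ m ∈ positiveCompositions F (s + 1), ∑ a ∈ F, (m a : ℝ) • a = x} := by
  have hs : ((s + 1 : ℕ) : ℝ) ≠ 0 := by positivity
  have hs' : (0 : ℝ) < ((s + 1 : ℕ) : ℝ) := by positivity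
  ext x
  simp only [Set.mem_ofPred_eq]
  constructor
  · rintro ⟨⟨q, hq, rfl⟩, hint⟩
    obtain ⟨F, hF, c, hc, hc1, rfl⟩ := hD.exists_rep q hq
    -- Unimodularity makes the scaled coefficients integers; being positive and of sum `s + 1`, they
    -- form a composition.
    have hz := exists_int_coeff F.card rfl (hD.subset F hF) (hD.linearIndepOn F hF)
      (fun a => ((s + 1 : ℕ) : ℝ) * c a) (by
        intro i
        obtain ⟨z, hz⟩ := hint i
        refine ⟨z, ?_⟩
        rw [← hz]
        simp [Finset.mul_sum, mul_assoc])
    have hm : ∀ a ∈ F, ∃ k : ℕ, ((s + 1 : ℕ) : ℝ) * c a = k := by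
      intro a ha
      obtain ⟨z, hz⟩ := hz a ha
      have h0 : (0 : ℝ) ≤ z := by rw [← hz]; have := hc a ha; positivity
      lift z to ℕ using (by exact_mod_cast h0)
      exact ⟨z, by simpa using hz⟩
    choose! k hk using hm
    refine ⟨F, hF, Finsupp.indicator F fun a _ => k a, ?_, ?_⟩
    · rw [mem_positiveCompositions]
      refine ⟨⟨?_, Finsupp.support_indicator_subset F _⟩, ?_⟩
      · have : ((∑ a ∈ F, k a : ℕ) : ℝ) = ((s + 1 : ℕ) : ℝ) := by
          rw [Nat.cast_sum, ← Finset.sum_congr rfl hk, ← Finset.mul_sum, hc1, mul_one]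
        rw [← Nat.cast_injective this]
        exact Finset.sum_congr rfl fun a ha => by simp [Finsupp.indicator_apply, ha]
      · intro a ha
        have : (0 : ℝ) < k a := by rw [← hk a ha]; have := hc a ha; positivity
        simpa [Finsupp.indicator_apply, ha] using this
    · simp only [Finset.smul_sum, smul_smul]
      refine Finset.sum_congr rfl fun a ha => ?_
      rw [hk a ha]
      simp [Finsupp.indicator_apply, ha]
  · rintro ⟨F, hF, m, hm, rfl⟩
    rw [mem_positiveCompositions] at hm
    constructor
    · refine ⟨∑ a ∈ F, ((m a : ℝ) / ((s + 1 : ℕ) : ℝ)) • a, ?_, ?_⟩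
      · refine (convex_convexHull ℝ _).sum_mem (fun a _ => by positivity) ?_
          (fun a ha => subset_convexHull ℝ _ (hD.subset F hF ha))
        rw [← Finset.sum_div, ← Nat.cast_sum, hm.1.1, div_self hs]
      · simp only [Finset.smul_sum, smul_smul]
        refine Finset.sum_congr rfl fun a _ => ?_
        rw [mul_div_cancel₀ _ hs]
    · intro i
      have : ∀ a : E ⊕ V → ℝ, ∃ z : ℤ, a ∈ F → (m a : ℝ) * a i = z := by
        intro a
        by_cases ha : a ∈ F
        · rcases edgeVectors_apply (hD.subset F hF ha) i with h | h
          · exact ⟨0, fun _ => by simp [h]⟩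
          · exact ⟨m a, fun _ => by simp [h]⟩
        · exact ⟨0, fun h => absurd h ha⟩
      choose z hz using this
      refine ⟨∑ a ∈ F, z a, ?_⟩
      rw [Int.cast_sum, ← Finset.sum_congr rfl fun a ha => hz a ha]
      simp

/-- The Ehrhart function in terms of a representation complex. -/
theorem ehrhart_succ {D : Finset (Finset (E ⊕ V → ℝ))}
    (hD : IsRepresentationComplex (edgeVectors G) D) (s : ℕ) :
    ehrhart G (s + 1) = ∑ F ∈ D, (positiveCompositions F (s + 1)).card := by
  classical
  have hs : ((s + 1 : ℕ) : ℝ) ≠ 0 := by positivity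
  rw [ehrhart, latticePoints_eq hD]
  have : {x | ∃ F ∈ D, ∃ m ∈ positiveCompositions F (s + 1), ∑ a ∈ F, (m a : ℝ) • a = x} =
      ((D.biUnion fun F => (positiveCompositions F (s + 1)).image fun m =>
        ∑ a ∈ F, (m a : ℝ) • a : Finset (E ⊕ V → ℝ)) : Set (E ⊕ V → ℝ)) := by
    ext x
    simp
  rw [this, Set.ncard_coe_finset, Finset.card_biUnion]
  · refine Finset.sum_congr rfl fun F hF => Finset.card_image_of_injOn ?_
    intro m hm m' hm' h
    have hm := mem_positiveCompositions.1 (Finset.mem_coe.1 hm)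
    have hm' := mem_positiveCompositions.1 (Finset.mem_coe.1 hm')
    have h0 : ∑ a ∈ F, ((m a : ℝ) - m' a) • id a = 0 := by
      simp only [sub_smul, Finset.sum_sub_distrib, id]
      exact sub_eq_zero.2 h
    ext a
    by_cases ha : a ∈ F
    · have := linearIndepOn_finset_iff.1 (hD.linearIndepOn F hF) _ h0 a ha
      exact_mod_cast sub_eq_zero.1 this
    · rw [Finsupp.notMem_support_iff.1 fun h => ha (hm.1.2 h),
        Finsupp.notMem_support_iff.1 fun h => ha (hm'.1.2 h)]
  · intro F hF F' hF' hne
    refine Finset.disjoint_left.2 ?_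
    intro x hx hx'
    obtain ⟨m, hm, rfl⟩ := Finset.mem_image.1 hx
    obtain ⟨m', hm', h⟩ := Finset.mem_image.1 hx'
    rw [mem_positiveCompositions] at hm hm'
    -- Dividing by `s + 1` turns both compositions into convex representations of one point of the
    -- polytope.
    refine hne (hD.unique F hF F' hF' (fun a => (m a : ℝ) / ((s + 1 : ℕ) : ℝ))
      (fun a => (m' a : ℝ) / ((s + 1 : ℕ) : ℝ)) (fun a ha => ?_) (fun a ha => ?_) ?_ ?_ ?_)
    · have : (0 : ℝ) < m a := by exact_mod_cast hm.2 a ha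
      positivity
    · have : (0 : ℝ) < m' a := by exact_mod_cast hm'.2 a ha
      positivity
    · rw [← Finset.sum_div, ← Nat.cast_sum, hm.1.1, div_self hs]
    · rw [← Finset.sum_div, ← Nat.cast_sum, hm'.1.1, div_self hs]
    · simp only [div_eq_inv_mul, mul_smul, ← Finset.smul_sum]
      rw [h]

end Count

/-! ### Lexicographic order and maxima -/

section Lex

variable {ι : Type*}

/-- The nonzero entry of `z` with the least rank is positive. -/
def LexPos (r : ι → ℕ) (z : ι → ℝ) : Prop :=
  ∃ i, 0 < z i ∧ ∀ j, r j < r i → z j = 0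

theorem lexPos_or_lexPos_neg [Finite ι] (r : ι → ℕ) {z : ι → ℝ}
    {i : ι} (hi : z i ≠ 0) : LexPos r z ∨ LexPos r (-z) := by
  classical
  have := Fintype.ofFinite ι
  obtain ⟨j, hj, hmin⟩ := (Finset.univ.filter fun i => z i ≠ 0).exists_min_image r
    ⟨i, by simpa using hi⟩
  have h0 : ∀ k, r k < r j → z k = 0 := by
    intro k hk
    by_contra h
    exact absurd (hmin k (by simpa using h)) (not_le.2 hk)
  rcases lt_or_gt_of_ne (Finset.mem_filter.1 hj).2 with h | h
  · exact Or.inr ⟨j, by simpa using h, fun k hk => by simpa using h0 k hk⟩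
  · exact Or.inl ⟨j, h, h0⟩

/-- A nonempty compact set of vectors has a lexicographic maximum. -/
theorem exists_lex_max [Finite ι] {r : ι → ℕ} (hr : Function.Injective r) {K : Set (ι → ℝ)}
    (hK : IsCompact K) (hne : K.Nonempty) : ∃ c ∈ K, ∀ c' ∈ K, ¬ LexPos r (c' - c) := by
  -- `K'` results from maximizing the coordinates of rank below `N` one after another. Membership in
  -- it depends only on these coordinates, and each is maximal given the earlier ones.
  have key : ∀ N : ℕ, ∃ K' ⊆ K, IsCompact K' ∧ K'.Nonempty ∧ ∀ c ∈ K', ∀ c' ∈ K,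
      ((∀ j, r j < N → c' j = c j) → c' ∈ K') ∧
      ∀ i, r i < N → (∀ j, r j < r i → c' j = c j) → c' i ≤ c i := by
    intro N
    induction N with
    | zero => exact ⟨K, subset_rfl, hK, hne, fun c _ c' hc' => ⟨fun _ => hc', by simp⟩⟩
    | succ N ih =>
      obtain ⟨K', hK'K, hK', hne', h⟩ := ih
      by_cases hN : ∃ i, r i = N
      · obtain ⟨i, hi⟩ := hN
        obtain ⟨c₀, hc₀, hmax⟩ := hK'.exists_isMaxOn hne' (continuous_apply i).continuousOn
        refine ⟨K' ∩ {c | c i = c₀ i}, Set.inter_subset_left.trans hK'K,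
          hK'.inter_right (isClosed_eq (continuous_apply i) continuous_const), ⟨c₀, hc₀, rfl⟩, ?_⟩
        rintro c ⟨hc, hci⟩ c' hc'
        have hci : c i = c₀ i := hci
        refine ⟨fun hagree => ⟨(h c hc c' hc').1 fun j hj => hagree j (by omega), ?_⟩, ?_⟩
        · exact (hagree i (by omega)).trans hci
        · intro j hj hagree
          rcases Nat.lt_succ_iff_lt_or_eq.1 hj with hj | hj
          · exact (h c hc c' hc').2 j hj hagree
          · have hij : j = i := hr (hj.trans hi.symm)
            subst hij
            rw [hci]
            exact hmax ((h c hc c' hc').1 fun k hk => hagree k (by omega))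
      · refine ⟨K', hK'K, hK', hne', fun c hc c' hc' => ⟨fun hagree => ?_, fun i hi => ?_⟩⟩
        · exact (h c hc c' hc').1 fun j hj => hagree j (by omega)
        · refine (h c hc c' hc').2 i ?_
          have : r i ≠ N := fun h => hN ⟨i, h⟩
          omega
  obtain ⟨N, hN⟩ := (Set.finite_range r).bddAbove
  obtain ⟨K', hK'K, -, ⟨c, hc⟩, h⟩ := key (N + 1)
  refine ⟨c, hK'K hc, ?_⟩
  rintro c' hc' ⟨i, hi, hagree⟩
  have := (h c hc c' hc').2 i (Nat.lt_succ_of_le (hN ⟨i, rfl⟩))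
    fun j hj => sub_eq_zero.1 (hagree j hj)
  simp only [Pi.sub_apply] at hi
  linarith

end Lex

/-! ### The complex of lexicographically maximal supports -/

section LexComplex

variable {W : Type*} [AddCommGroup W] [Module ℝ W]

open Classical in
/-- The supports of the lexicographically maximal representations: the sets that do not contain the
negative part of a lexicographically positive linear relation. -/
noncomputable def lexComplex (A : Finset W) (r : A → ℕ) : Finset (Finset W) :=
  A.powerset.filter fun F => ¬ ∃ z : A → ℝ, ∑ a, z a • (a : W) = 0 ∧ LexPos r z ∧
    ∀ a, z a < 0 → (a : W) ∈ F

variable {A : Finset W} {r : A → ℕ}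

theorem mem_lexComplex {F : Finset W} : F ∈ lexComplex A r ↔ F ⊆ A ∧
    ∀ z : A → ℝ, ∑ a, z a • (a : W) = 0 → LexPos r z → ∃ a, z a < 0 ∧ (a : W) ∉ F := by
  classical
  rw [lexComplex, Finset.mem_filter, Finset.mem_powerset]
  push Not
  rfl

theorem lexComplex_subset {F F' : Finset W} (hF : F ∈ lexComplex A r) (h : F' ⊆ F) :
    F' ∈ lexComplex A r := by
  rw [mem_lexComplex] at hF ⊢
  refine ⟨h.trans hF.1, fun z hz hpos => ?_⟩
  obtain ⟨a, ha, haF⟩ := hF.2 z hz hpos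
  exact ⟨a, ha, fun h' => haF (h h')⟩

theorem sum_relation_eq_zero (φ : W →ₗ[ℝ] ℝ) (hφ : ∀ a ∈ A, φ a = 1) {z : A → ℝ}
    (hz : ∑ a, z a • (a : W) = 0) : ∑ a, z a = 0 := by
  have := congrArg φ hz
  rw [map_sum, map_zero] at this
  rw [← this]
  exact Finset.sum_congr rfl fun a _ => by rw [map_smul, hφ a a.2, smul_eq_mul, mul_one]

theorem empty_mem_lexComplex (φ : W →ₗ[ℝ] ℝ) (hφ : ∀ a ∈ A, φ a = 1) :
    ∅ ∈ lexComplex A r := by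
  rw [mem_lexComplex]
  refine ⟨Finset.empty_subset _, fun z hz hpos => ?_⟩
  by_contra! h
  have h0 : ∀ a, 0 ≤ z a := fun a => by
    by_contra h'
    simpa using h a (not_le.1 h')
  obtain ⟨i, hi, -⟩ := hpos
  have := (Finset.sum_eq_zero_iff_of_nonneg fun a _ => h0 a).1 (sum_relation_eq_zero φ hφ hz) i
    (Finset.mem_univ _)
  linarith

/-- The complex is a cone with the element of least rank as its apex. -/
theorem insert_mem_lexComplex [DecidableEq W] {a₀ : A} (ha₀ : ∀ a, a ≠ a₀ → r a₀ < r a)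
    {F : Finset W} (hF : F ∈ lexComplex A r) : insert (a₀ : W) F ∈ lexComplex A r := by
  rw [mem_lexComplex] at hF ⊢
  refine ⟨Finset.insert_subset a₀.2 hF.1, fun z hz hpos => ?_⟩
  obtain ⟨a, ha, haF⟩ := hF.2 z hz hpos
  refine ⟨a, ha, fun h => ?_⟩
  rcases Finset.mem_insert.1 h with h | h
  · have h : a = a₀ := Subtype.ext h
    obtain ⟨i, hi, hlt⟩ := hpos
    by_cases hia : i = a₀
    · rw [h, ← hia] at ha
      linarith
    · rw [h, hlt a₀ (ha₀ i hia)] at ha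
      exact lt_irrefl _ ha
  · exact haF h

/-- A function on `F`, extended by zero to `A`. -/
theorem sum_extend [DecidableEq W] {F : Finset W} (hF : F ⊆ A) (c : W → ℝ) :
    ∑ a : A, (if (a : W) ∈ F then c a else 0) • (a : W) = ∑ a ∈ F, c a • a := by
  rw [Finset.sum_coe_sort A fun a => (if a ∈ F then c a else 0) • a]
  simp only [ite_smul, zero_smul]
  rw [← Finset.sum_filter, Finset.filter_mem_eq_inter, Finset.inter_eq_right.2 hF]

/-- Every nonzero relation is lexicographically positive up to sign. A relation supported on a face,
or the difference of two representations by faces, would therefore have the negative part of itself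
or of its negative inside a face. Existence comes from a lexicographically maximal representation,
available by compactness of the simplex of coefficients. -/
theorem isRepresentationComplex_lexComplex [TopologicalSpace W] [ContinuousAdd W]
    [ContinuousSMul ℝ W] [T2Space W] (hr : Function.Injective r)
    (φ : W →ₗ[ℝ] ℝ) (hφ : ∀ a ∈ A, φ a = 1) :
    IsRepresentationComplex (A : Set W) (lexComplex A r) := by
  classical
  refine ⟨fun F hF => Finset.coe_subset.2 (mem_lexComplex.1 hF).1, ?_, ?_, ?_⟩
  · intro F hF
    rw [mem_lexComplex] at hF
    rw [linearIndepOn_finset_iff]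
    intro c hc a ha
    by_contra hca
    set z : A → ℝ := fun a => if (a : W) ∈ F then c a else 0 with hzdef
    have hz : ∑ a, z a • (a : W) = 0 := (sum_extend hF.1 c).trans hc
    have hzF : ∀ a, z a ≠ 0 → (a : W) ∈ F := fun a h => by
      by_contra h'
      simp [hzdef, h'] at h
    have hza : z ⟨a, hF.1 ha⟩ ≠ 0 := by simpa [hzdef, ha] using hca
    rcases lexPos_or_lexPos_neg r hza with h | h
    · obtain ⟨b, hb, hbF⟩ := hF.2 z hz h
      exact hbF (hzF b hb.ne)
    · obtain ⟨b, hb, hbF⟩ := hF.2 (-z) (by simpa [-Finset.univ_eq_attach] using hz) h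
      exact hbF (hzF b fun h => by simp [h] at hb)
  · intro q hq
    set K : Set (A → ℝ) := stdSimplex ℝ A ∩ {c | ∑ a, c a • (a : W) = q} with hKdef
    have hK : IsCompact K := (isCompact_stdSimplex ℝ A).inter_right
      (isClosed_eq (by fun_prop) continuous_const)
    have hne : K.Nonempty := by
      obtain ⟨w, hw0, hw1, hwq⟩ := Finset.mem_convexHull'.1 hq
      refine ⟨fun a => w a, ⟨fun a => hw0 a a.2, ?_⟩, ?_⟩
      · rw [← hw1]
        exact Finset.sum_coe_sort A w
      · rw [Set.mem_ofPred_eq, ← hwq]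
        exact Finset.sum_coe_sort A fun a => w a • a
    obtain ⟨c, ⟨⟨hc0, hc1⟩, hcq⟩, hmax⟩ := exists_lex_max hr hK hne
    have hcq : ∑ a, c a • (a : W) = q := hcq
    set F : Finset W := (Finset.univ.filter fun a => 0 < c a).map (Function.Embedding.subtype _)
      with hF
    have hmem : ∀ a : A, (a : W) ∈ F ↔ 0 < c a := fun a => by simp [hF]
    have hFA : F ⊆ A := by
      intro a ha
      simp only [hF, Finset.mem_map, Function.Embedding.subtype_apply] at ha
      obtain ⟨b, -, rfl⟩ := ha
      exact b.2
    refine ⟨F, ?_, fun a => if h : a ∈ A then c ⟨a, h⟩ else 0, ?_, ?_, ?_⟩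
    · rw [mem_lexComplex]
      refine ⟨hFA, fun z hz hpos => ?_⟩
      by_contra! hcon
      -- If the negative part of `z` lay in the support of `c`, a small step along `z` would keep
      -- all coefficients nonnegative and give a lexicographically larger representation of `q`.
      have hev : ∀ᶠ ε : ℝ in nhdsWithin 0 (Set.Ioi 0), 0 < ε ∧ ∀ a, 0 ≤ c a + ε * z a := by
        refine (eventually_mem_nhdsWithin).and (Filter.eventually_all.2 fun a => ?_)
        rcases lt_or_ge (z a) 0 with h | h
        · have hca : 0 < c a := (hmem a).1 (hcon a h)
          have ht : Filter.Tendsto (fun ε : ℝ => c a + ε * z a) (nhds 0) (nhds (c a + 0 * z a)) :=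
            Continuous.tendsto (by fun_prop) 0
          rw [zero_mul, add_zero] at ht
          exact ((ht.eventually (lt_mem_nhds hca)).mono fun _ h => h.le).filter_mono
            nhdsWithin_le_nhds
        · filter_upwards [eventually_mem_nhdsWithin] with ε hε
          have hε : 0 < ε := hε
          have := hc0 a
          positivity
      obtain ⟨ε, hε, hε0⟩ := hev.exists
      refine hmax (c + ε • z) ⟨⟨fun a => ?_, ?_⟩, ?_⟩ ?_
      · simpa using hε0 a
      · simp only [Pi.add_apply, Pi.smul_apply, smul_eq_mul, Finset.sum_add_distrib,
          ← Finset.mul_sum, sum_relation_eq_zero φ hφ hz, hc1, mul_zero, add_zero]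
      · simp only [Set.mem_ofPred_eq, Pi.add_apply, Pi.smul_apply, smul_eq_mul, add_smul, mul_smul,
          Finset.sum_add_distrib, ← Finset.smul_sum, hz, hcq, smul_zero, add_zero]
      · obtain ⟨i, hi, hlt⟩ := hpos
        rw [add_sub_cancel_left]
        exact ⟨i, by simpa using mul_pos hε hi, fun j hj => by simp [hlt j hj]⟩
    · intro a ha
      simpa [hFA ha] using (hmem ⟨a, hFA ha⟩).1 ha
    · rw [hF, Finset.sum_map, ← hc1, Finset.sum_filter]
      refine Finset.sum_congr rfl fun a _ => ?_
      rcases (hc0 a).lt_or_eq with h | h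
      · simp [h]
      · simp [← h]
    · rw [hF, Finset.sum_map, ← hcq, Finset.sum_filter]
      refine Finset.sum_congr rfl fun a _ => ?_
      rcases (hc0 a).lt_or_eq with h | h
      · simp [h]
      · simp [← h]
  · intro F hF F' hF' c c' hc hc' _ _ heq
    rw [mem_lexComplex] at hF hF'
    set z : A → ℝ := fun a => (if (a : W) ∈ F' then c' a else 0) -
      if (a : W) ∈ F then c a else 0 with hzdef
    have hz : ∑ a, z a • (a : W) = 0 := by
      simp only [hzdef, sub_smul, Finset.sum_sub_distrib]
      rw [sum_extend hF.1, sum_extend hF'.1, heq, sub_self]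
    have hzF : ∀ a, z a < 0 → (a : W) ∈ F := fun a h => by
      by_contra h'
      by_cases h'' : (a : W) ∈ F'
      · have := hc' a h''
        simp [hzdef, h', h''] at h
        linarith
      · simp [hzdef, h', h''] at h
    have hzF' : ∀ a, 0 < z a → (a : W) ∈ F' := fun a h => by
      by_contra h'
      by_cases h'' : (a : W) ∈ F
      · have := hc a h''
        simp [hzdef, h', h''] at h
        linarith
      · simp [hzdef, h', h''] at h
    have hz0 : ∀ a, z a = 0 := by
      intro a
      by_contra h
      rcases lexPos_or_lexPos_neg r h with h | h
      · obtain ⟨b, hb, hbF⟩ := hF.2 z hz h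
        exact hbF (hzF b hb)
      · obtain ⟨b, hb, hbF⟩ := hF'.2 (-z) (by simpa [-Finset.univ_eq_attach] using hz) h
        exact hbF (hzF' b (by simpa using hb))
    ext a
    constructor
    · intro ha
      have := hz0 ⟨a, hF.1 ha⟩
      by_contra h
      simp [hzdef, ha, h, (hc a ha).ne'] at this
    · intro ha
      have := hz0 ⟨a, hF'.1 ha⟩
      by_contra h
      simp [hzdef, ha, h, (hc' a ha).ne'] at this

end LexComplex

/-! ### Existence of the expansion -/

section Polynomiality

variable {E V : Type*} [DecidableEq E] [DecidableEq V] [Fintype E] {G : SimpleGraph (E ⊕ V)}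

/-- The sum of the coordinates in the color class `E`. -/
def sumInl (E V : Type*) [Fintype E] : (E ⊕ V → ℝ) →ₗ[ℝ] ℝ :=
  ∑ e : E, LinearMap.proj (Sum.inl e)

theorem sumInl_edgeVectors {a : E ⊕ V → ℝ} (ha : a ∈ edgeVectors G) : sumInl E V a = 1 := by
  rw [← edgeVectors_sum_inl ha]
  simp [sumInl]

/-- An injective ranking of a finite type with a prescribed least element. -/
theorem exists_injective_rank {ι : Type*} [Finite ι] (i₀ : ι) :
    ∃ r : ι → ℕ, Function.Injective r ∧ ∀ i, i ≠ i₀ → r i₀ < r i := by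
  classical
  obtain ⟨n, ⟨f⟩⟩ := Finite.exists_equiv_fin ι
  refine ⟨fun i => if i = i₀ then 0 else (f i : ℕ) + 1, ?_, fun i hi => by simp [hi]⟩
  intro i j hij
  by_cases hi : i = i₀ <;> by_cases hj : j = i₀
  · exact hi.trans hj.symm
  · simp [hi, hj] at hij
  · simp [hi, hj] at hij
  · simpa [hi, hj, Fin.val_inj] using hij

/-- Pascal's rule; for empty `F` the first summand is zero and both sides are one. -/
theorem card_positiveCompositions_add_insert {W : Type*} [DecidableEq W] {F : Finset W} {a : W}
    (ha : a ∉ F) (s : ℕ) :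
    (positiveCompositions F (s + 1)).card + (positiveCompositions (insert a F) (s + 1)).card =
      (s + 1).choose F.card := by
  rw [card_positiveCompositions (Finset.insert_nonempty a F), Finset.card_insert_of_notMem ha,
    Nat.add_sub_cancel]
  rcases F.eq_empty_or_nonempty with rfl | hF
  · rw [card_positiveCompositions_empty]
    simp
  · rw [card_positiveCompositions hF]
    obtain ⟨k, hk⟩ := Nat.exists_eq_succ_of_ne_zero hF.card_pos.ne'
    rw [hk, Nat.succ_sub_one, Nat.succ_eq_add_one, Nat.choose_succ_succ]

variable [Fintype V]

/-- Each face avoiding the apex `a₀` is paired with its join with `a₀`. The join has at most `d + 1`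
elements, whence `F.card ≤ d`. At `s = 0` only the empty face contributes. -/
theorem exists_ehrhart_eq_sum_choose (hG : (edgeVectors G).Nonempty) {d : ℕ}
    (hd : Fintype.card E + Fintype.card V = d + 2) :
    ∃ D : Finset (Finset (E ⊕ V → ℝ)), (∀ F ∈ D, F.card ≤ d) ∧
      ∀ s, ehrhart G s = ∑ F ∈ D, s.choose F.card := by
  classical
  set A : Finset (E ⊕ V → ℝ) := (edgeVectors_finite G).toFinset with hA
  have hAG : (A : Set (E ⊕ V → ℝ)) = edgeVectors G := Set.Finite.coe_toFinset _
  have hφ : ∀ a ∈ A, sumInl E V a = 1 := fun a ha =>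
    sumInl_edgeVectors (G := G) (by simpa [hA] using ha)
  obtain ⟨a₀, ha₀⟩ := hG
  have ha₀A : a₀ ∈ A := by simpa [hA] using ha₀
  obtain ⟨r, hr, hmin⟩ := exists_injective_rank (⟨a₀, ha₀A⟩ : A)
  have hD := isRepresentationComplex_lexComplex hr _ hφ
  rw [hAG] at hD
  have hins : ∀ F ∈ lexComplex A r, insert a₀ F ∈ lexComplex A r := fun F hF =>
    insert_mem_lexComplex hmin hF
  refine ⟨(lexComplex A r).filter fun F => a₀ ∉ F, ?_, ?_⟩
  · intro F hF
    rw [Finset.mem_filter] at hF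
    have h := hins F hF.1
    obtain ⟨e, v, -, -⟩ := ha₀
    have := card_lt_of_linearIndepOn (hD.subset _ h) (hD.linearIndepOn _ h)
      (Finset.mem_univ (Sum.inl e)) (fun a _ i hi => absurd (Finset.mem_univ i) hi)
    rw [Finset.card_insert_of_notMem hF.2, Finset.card_univ, Fintype.card_sum, hd] at this
    omega
  · intro s
    cases s with
    | zero =>
      rw [ehrhart_zero ⟨a₀, ha₀⟩, Finset.sum_eq_single ∅]
      · simp
      · intro F _ hF
        exact Nat.choose_eq_zero_of_lt (Finset.card_pos.2 (Finset.nonempty_iff_ne_empty.2 hF))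
      · intro h
        exact absurd (Finset.mem_filter.2 ⟨empty_mem_lexComplex _ hφ, by simp⟩) h
    | succ s =>
      rw [ehrhart_succ hD, ← Finset.sum_filter_add_sum_filter_not _ (fun F => a₀ ∉ F)]
      have himage : (lexComplex A r).filter (fun F => ¬ a₀ ∉ F) =
          ((lexComplex A r).filter fun F => a₀ ∉ F).image (insert a₀) := by
        ext F
        simp only [Finset.mem_filter, Finset.mem_image, not_not]
        constructor
        · rintro ⟨hF, haF⟩
          exact ⟨F.erase a₀, ⟨lexComplex_subset hF (Finset.erase_subset _ _),
            Finset.notMem_erase _ _⟩, Finset.insert_erase haF⟩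
        · rintro ⟨F', ⟨hF', -⟩, rfl⟩
          exact ⟨hins F' hF', Finset.mem_insert_self _ _⟩
      rw [himage, Finset.sum_image, ← Finset.sum_add_distrib]
      · exact Finset.sum_congr rfl fun F hF =>
          card_positiveCompositions_add_insert (Finset.mem_filter.1 hF).2 s
      · intro F hF F' hF' h
        have hF := (Finset.mem_filter.1 (Finset.mem_coe.1 hF)).2
        have hF' := (Finset.mem_filter.1 (Finset.mem_coe.1 hF')).2
        rw [← Finset.erase_insert hF, ← Finset.erase_insert hF']
        exact congrArg (fun S => S.erase a₀) h

theorem exists_isEhrhartExpansion (hG : (edgeVectors G).Nonempty) {d : ℕ}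
    (hd : Fintype.card E + Fintype.card V = d + 2) :
    ∃ a : Fin (d + 1) → ℚ, IsEhrhartExpansion G d a := by
  obtain ⟨D, hD, h⟩ := exists_ehrhart_eq_sum_choose hG hd
  obtain ⟨a, ha⟩ := exists_expansion_sum_choose D Finset.card hD
  refine ⟨a, fun s => ?_⟩
  rw [← ha s, h s, Nat.cast_sum]

end Polynomiality

/-! ### Triangulations as representation complexes -/

section TriangulationComplex

variable {W : Type*}

open Classical in
/-- The simplicial complex of all faces of members of `T`. -/
noncomputable def faceComplex (T : Finset (Finset W)) : Finset (Finset W) :=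
  T.biUnion Finset.powerset

theorem mem_faceComplex {T : Finset (Finset W)} {F : Finset W} :
    F ∈ faceComplex T ↔ ∃ s ∈ T, F ⊆ s := by
  simp [faceComplex]

theorem faceCount_eq (T : Finset (Finset W)) (k : ℕ) :
    faceCount T k = ((faceComplex T).filter fun F => F.card = k + 1).card := by
  rw [faceCount, ← Set.ncard_coe_finset]
  congr 1
  ext F
  simp [mem_faceComplex, and_comm]

variable [AddCommGroup W] [Module ℝ W]

/-- Affinely independent points in an affine hyperplane that misses the origin are linearly
independent. -/
theorem linearIndepOn_of_affineIndependent {s : Finset W} (φ : W →ₗ[ℝ] ℝ)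
    (hφ : ∀ a ∈ s, φ a = 1) (hs : AffineIndependent ℝ ((↑) : s → W)) :
    LinearIndepOn ℝ id (s : Set W) := by
  rw [linearIndepOn_finset_iff]
  intro c hc a ha
  have h0 : ∑ b ∈ s, c b = 0 := by
    have := congrArg φ hc
    rw [map_sum, map_zero] at this
    rw [← this]
    exact Finset.sum_congr rfl fun b hb => by simp [hφ b hb]
  refine affineIndependent_iff.1 hs Finset.univ (fun b => c b) ?_ ?_ ⟨a, ha⟩ (Finset.mem_univ _)
  · rw [← h0]
    exact Finset.sum_coe_sort s c
  · rw [← hc]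
    exact Finset.sum_coe_sort s fun b => c b • b

/-- Two representations by elements of a linearly independent set have the same positive
support. -/
theorem eq_filter_of_sum_eq {s F u : Finset W} (hs : LinearIndepOn ℝ id (s : Set W)) (hF : F ⊆ s)
    (hu : u ⊆ s) {c w : W → ℝ} (hc : ∀ a ∈ F, 0 < c a)
    (h : ∑ a ∈ F, c a • a = ∑ a ∈ u, w a • a) : F = u.filter fun a => 0 < w a := by
  classical
  have hsum : ∀ (F : Finset W) (c : W → ℝ), F ⊆ s →
      ∑ a ∈ s, (if a ∈ F then c a else 0) • a = ∑ a ∈ F, c a • a := by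
    intro F c hF
    simp only [ite_smul, zero_smul]
    rw [← Finset.sum_filter, Finset.filter_mem_eq_inter, Finset.inter_eq_right.2 hF]
  have h0 := linearIndepOn_finset_iff.1 hs
    (fun a => (if a ∈ F then c a else 0) - if a ∈ u then w a else 0) (by
      simp only [sub_smul, Finset.sum_sub_distrib, id]
      rw [hsum F c hF, hsum u w hu, h, sub_self])
  ext a
  rw [Finset.mem_filter]
  constructor
  · intro ha
    have h1 := h0 a (hF ha)
    have h2 := hc a ha
    by_cases hau : a ∈ u
    · simp only [ha, hau, if_true] at h1
      exact ⟨hau, by linarith⟩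
    · simp only [ha, hau, if_true, if_false] at h1
      linarith
  · rintro ⟨hau, hwa⟩
    have h1 := h0 a (hu hau)
    by_contra ha
    simp only [ha, hau, if_true, if_false] at h1
    linarith

/-- For uniqueness, a point interior to faces `F ⊆ s` and `F' ⊆ t` lies in the common face spanned
by `u`. Its representation by `u` is the only one within `s` and within `t`, so `F` and `F'` both
equal its positive support. -/
theorem IsTriangulation.isRepresentationComplex {A : Set W} {T : Finset (Finset W)}
    (hT : IsTriangulation (convexHull ℝ A) T) (φ : W →ₗ[ℝ] ℝ) (hφ : ∀ a ∈ A, φ a = 1) :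
    IsRepresentationComplex A (faceComplex T) := by
  have hTA : ∀ s ∈ T, (s : Set W) ⊆ A := fun s hs =>
    (hT.subset_vertices s hs).trans extremePoints_convexHull_subset
  have hli : ∀ s ∈ T, LinearIndepOn ℝ id (s : Set W) := fun s hs =>
    linearIndepOn_of_affineIndependent φ (fun a ha => hφ a (hTA s hs ha))
      (hT.affineIndependent s hs)
  have hmem : ∀ {s F : Finset W} {c : W → ℝ}, F ⊆ s → (∀ a ∈ F, 0 < c a) → ∑ a ∈ F, c a = 1 →
      ∑ a ∈ F, c a • a ∈ convexHull ℝ (s : Set W) := fun hFs hc h1 =>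
    (convex_convexHull ℝ _).sum_mem (fun a ha => (hc a ha).le) h1
      fun a ha => subset_convexHull ℝ _ (hFs ha)
  refine ⟨fun F hF => ?_, fun F hF => ?_, fun q hq => ?_, ?_⟩
  · obtain ⟨s, hs, hFs⟩ := mem_faceComplex.1 hF
    exact (Finset.coe_subset.2 hFs).trans (hTA s hs)
  · obtain ⟨s, hs, hFs⟩ := mem_faceComplex.1 hF
    exact (hli s hs).mono (Finset.coe_subset.2 hFs)
  · rw [← hT.union_eq] at hq
    simp only [Set.mem_iUnion] at hq
    obtain ⟨s, hs, hq⟩ := hq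
    obtain ⟨w, hw0, hw1, hwq⟩ := Finset.mem_convexHull'.1 hq
    refine ⟨s.filter fun a => 0 < w a, mem_faceComplex.2 ⟨s, hs, Finset.filter_subset _ _⟩, w,
      fun a ha => (Finset.mem_filter.1 ha).2, ?_, ?_⟩
    · rw [← hw1]
      exact Finset.sum_filter_of_ne fun a ha h => lt_of_le_of_ne (hw0 a ha) h.symm
    · rw [← hwq]
      refine Finset.sum_filter_of_ne fun a ha h => lt_of_le_of_ne (hw0 a ha) ?_
      rintro h'
      rw [← h', zero_smul] at h
      exact h rfl
  · intro F hF F' hF' c c' hc hc' hc1 hc1' heq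
    obtain ⟨s, hs, hFs⟩ := mem_faceComplex.1 hF
    obtain ⟨t, ht, hFt⟩ := mem_faceComplex.1 hF'
    obtain ⟨u, hus, hut, hu⟩ := hT.inter_face s hs t ht
    have hq : ∑ a ∈ F, c a • a ∈ convexHull ℝ (u : Set W) := by
      rw [← hu]
      refine ⟨hmem hFs hc hc1, ?_⟩
      rw [heq]
      exact hmem hFt hc' hc1'
    obtain ⟨w, -, -, hwq⟩ := Finset.mem_convexHull'.1 hq
    rw [eq_filter_of_sum_eq (hli s hs) hFs hus hc hwq.symm,
      eq_filter_of_sum_eq (hli t ht) hFt hut hc' (heq.symm.trans hwq.symm)]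

end TriangulationComplex

/-! ### Dimension of the root polytope -/

section Dimension

variable {E V : Type*} [DecidableEq E] [DecidableEq V] {G : SimpleGraph (E ⊕ V)}

theorem single_add_single_mem_edgeVectors (hbip : G ≤ completeBipartiteGraph E V) {x y : E ⊕ V}
    (h : G.Adj x y) : (Pi.single x 1 + Pi.single y 1 : E ⊕ V → ℝ) ∈ edgeVectors G := by
  have hb := hbip h
  rcases x with e | v <;> rcases y with e' | v'
  · simp at hb
  · exact ⟨e, v', h, rfl⟩
  · exact ⟨e', v, h.symm, add_comm _ _⟩
  · simp at hb

theorem edgeVectors_nonempty [Fintype E] [Fintype V] (hbip : G ≤ completeBipartiteGraph E V)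
    (hconn : G.Connected) {d : ℕ} (hd : Fintype.card E + Fintype.card V = d + 2) :
    (edgeVectors G).Nonempty := by
  have : Nontrivial (E ⊕ V) := by
    rw [← Fintype.one_lt_card_iff_nontrivial, Fintype.card_sum]
    omega
  obtain ⟨x⟩ := hconn.nonempty
  obtain ⟨y, hy⟩ := hconn.preconnected.exists_adj_of_nontrivial x
  exact ⟨_, single_add_single_mem_edgeVectors hbip hy⟩

/-- The edge vectors of a connected bipartite graph span a hyperplane. -/
theorem card_le_finrank_span_edgeVectors [Fintype E] [Fintype V]
    (hbip : G ≤ completeBipartiteGraph E V) (hconn : G.Connected) :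
    Fintype.card E + Fintype.card V ≤
      Module.finrank ℝ (Submodule.span ℝ (edgeVectors G)) + 1 := by
  obtain ⟨x₀⟩ := hconn.nonempty
  -- One basis vector is adjoined to the span; subtracting along edges, connectedness yields all the
  -- others, so the span has codimension at most one.
  set P : Submodule ℝ (E ⊕ V → ℝ) :=
    Submodule.span ℝ (edgeVectors G) ⊔ Submodule.span ℝ {Pi.single x₀ 1} with hP
  have hstep : ∀ x y, G.Adj x y → (Pi.single x 1 : E ⊕ V → ℝ) ∈ P →
      (Pi.single y 1 : E ⊕ V → ℝ) ∈ P := by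
    intro x y hxy hx
    have h : (Pi.single x 1 + Pi.single y 1 : E ⊕ V → ℝ) ∈ P :=
      Submodule.mem_sup_left (Submodule.subset_span (single_add_single_mem_edgeVectors hbip hxy))
    simpa using P.sub_mem h hx
  have hall : ∀ x, (Pi.single x 1 : E ⊕ V → ℝ) ∈ P := by
    intro x
    have := (SimpleGraph.reachable_iff_reflTransGen x₀ x).1 (hconn.preconnected x₀ x)
    induction this with
    | refl => exact Submodule.mem_sup_right (Submodule.mem_span_singleton_self _)
    | tail _ h ih => exact hstep _ _ h ih
  have htop : P = ⊤ := by
    rw [eq_top_iff, ← (Pi.basisFun ℝ (E ⊕ V)).span_eq, Submodule.span_le]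
    rintro _ ⟨x, rfl⟩
    rw [Pi.basisFun_apply]
    exact hall x
  have h1 := Submodule.finrank_add_le_finrank_add_finrank (Submodule.span ℝ (edgeVectors G))
    (Submodule.span ℝ {(Pi.single x₀ 1 : E ⊕ V → ℝ)})
  rw [← hP, htop, finrank_top, Module.finrank_fintype_fun_eq_card, Fintype.card_sum] at h1
  have h2 : Module.finrank ℝ (Submodule.span ℝ {(Pi.single x₀ 1 : E ⊕ V → ℝ)}) ≤ 1 :=
    (finrank_span_le_card _).trans (by simp)
  omega

/-- Independence of edge vectors bounds the size above by `d + 1`; spanning the same affine space as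
the polytope bounds it below. -/
theorem IsTriangulation.card_eq [Fintype E] [Fintype V]
    (hbip : G ≤ completeBipartiteGraph E V) (hconn : G.Connected)
    {d : ℕ} (hd : Fintype.card E + Fintype.card V = d + 2) {T : Finset (Finset (E ⊕ V → ℝ))}
    (hT : IsTriangulation (rootPolytope G) T) {s : Finset (E ⊕ V → ℝ)} (hs : s ∈ T) :
    s.card = d + 1 := by
  have hD := hT.isRepresentationComplex (sumInl E V) fun a ha => sumInl_edgeVectors ha
  have hsD := mem_faceComplex.2 ⟨s, hs, subset_rfl⟩
  have hli := hD.linearIndepOn s hsD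
  obtain ⟨x₀⟩ := hconn.nonempty
  have hlt := card_lt_of_linearIndepOn (hD.subset s hsD) hli (Finset.mem_univ x₀)
    (fun a _ i hi => absurd (Finset.mem_univ i) hi)
  rw [Finset.card_univ, Fintype.card_sum, hd] at hlt
  have hspan : Submodule.span ℝ (edgeVectors G) ≤
      Submodule.span ℝ (s : Set (E ⊕ V → ℝ)) := by
    rw [Submodule.span_le]
    intro a ha
    have h1 : a ∈ affineSpan ℝ (rootPolytope G) :=
      subset_affineSpan ℝ _ (subset_convexHull ℝ _ ha)
    rw [← hT.affineSpan_eq s hs] at h1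
    exact affineSpan_subset_span h1
  have h1 := Submodule.finrank_mono hspan
  have h2 := card_le_finrank_span_edgeVectors hbip hconn
  have h3 := finrank_span_finset_le_card (R := ℝ) s
  rw [Set.finrank] at h3
  omega

theorem IsTriangulation.complexDim_eq [Fintype E] [Fintype V]
    (hbip : G ≤ completeBipartiteGraph E V) (hconn : G.Connected)
    {d : ℕ} (hd : Fintype.card E + Fintype.card V = d + 2) {T : Finset (Finset (E ⊕ V → ℝ))}
    (hT : IsTriangulation (rootPolytope G) T) : complexDim T = d := by
  obtain ⟨a, ha⟩ := edgeVectors_nonempty hbip hconn hd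
  have ha : a ∈ rootPolytope G := subset_convexHull ℝ _ ha
  rw [← hT.union_eq] at ha
  simp only [Set.mem_iUnion] at ha
  obtain ⟨s, hs, -⟩ := ha
  have : T.sup Finset.card = d + 1 := by
    apply le_antisymm
    · exact Finset.sup_le fun t ht => (hT.card_eq hbip hconn hd ht).le
    · rw [← hT.card_eq hbip hconn hd hs]
      exact Finset.le_sup (f := Finset.card) hs
  rw [complexDim, this, Nat.add_sub_cancel]

end Dimension

/-! ### The h-vector and the Ehrhart coefficients -/

section HVector

variable {E V : Type*} [DecidableEq E] [DecidableEq V] [Fintype E] [Fintype V]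
variable {G : SimpleGraph (E ⊕ V)}

theorem IsTriangulation.ehrhart_succ_eq (hbip : G ≤ completeBipartiteGraph E V)
    (hconn : G.Connected) {d : ℕ} (hd : Fintype.card E + Fintype.card V = d + 2)
    {T : Finset (Finset (E ⊕ V → ℝ))} (hT : IsTriangulation (rootPolytope G) T) (s : ℕ) :
    ehrhart G (s + 1) = ∑ k ∈ Finset.range (d + 1), faceCount T k * s.choose k := by
  classical
  have hD := hT.isRepresentationComplex (sumInl E V) fun a ha => sumInl_edgeVectors ha
  have hcard : ∀ F ∈ faceComplex T, F.card ∈ Finset.range (d + 2) := by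
    intro F hF
    obtain ⟨t, ht, hFt⟩ := mem_faceComplex.1 hF
    have := Finset.card_le_card hFt
    rw [hT.card_eq hbip hconn hd ht] at this
    rw [Finset.mem_range]
    omega
  rw [ehrhart_succ hD, ← Finset.sum_fiberwise_of_maps_to hcard, Finset.sum_range_succ']
  rw [Finset.sum_eq_zero (s := (faceComplex T).filter fun F => F.card = 0), add_zero]
  · refine Finset.sum_congr rfl fun k _ => ?_
    rw [faceCount_eq, ← smul_eq_mul, ← Finset.sum_const]
    refine Finset.sum_congr rfl fun F hF => ?_
    have hF := (Finset.mem_filter.1 hF).2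
    rw [card_positiveCompositions (Finset.card_pos.1 (by omega)), hF, Nat.add_sub_cancel]
  · intro F hF
    rw [Finset.card_eq_zero.1 (Finset.mem_filter.1 hF).2, card_positiveCompositions_empty]

/-- Rests on $x(x^{-1}-1)=1-x$, with $x^{d+1}$ split as $x^{k+1}x^{d-k}$ in the $k$-th term. -/
theorem pow_mul_eval_hVector {W : Type*} (T : Finset (Finset W)) [AddCommGroup W] [Module ℝ W]
    {d : ℕ} (hT : complexDim T = d) {x : ℚ} (hx : x ≠ 0) :
    x ^ (d + 1) * (hVector T).eval x⁻¹ =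
      ((1 - Polynomial.X) ^ (d + 1) + ∑ k ∈ Finset.range (d + 1),
        Polynomial.C (faceCount T k : ℚ) *
          (Polynomial.X ^ (k + 1) * (1 - Polynomial.X) ^ (d - k)) : Polynomial ℚ).eval x := by
  have hpow : ∀ n : ℕ, x ^ n * (x⁻¹ - 1) ^ n = (1 - x) ^ n := fun n => by
    rw [← mul_pow, mul_sub, mul_inv_cancel₀ hx, mul_one]
  simp only [hVector, fVector, hT, Polynomial.eval_comp, Polynomial.eval_add, Polynomial.eval_sub,
    Polynomial.eval_X, Polynomial.eval_one, Polynomial.eval_pow, Polynomial.eval_finsetSum,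
    Polynomial.eval_mul, Polynomial.eval_C, mul_add, hpow, Finset.mul_sum]
  congr 1
  refine Finset.sum_congr rfl fun k hk => ?_
  rw [← hpow (d - k)]
  have hd : d + 1 = (k + 1) + (d - k) := by have := Finset.mem_range.1 hk; omega
  rw [hd, pow_add]
  ring

theorem IsTriangulation.pow_mul_eval_hVector_eq (hbip : G ≤ completeBipartiteGraph E V)
    (hconn : G.Connected) {d : ℕ} (hd : Fintype.card E + Fintype.card V = d + 2)
    {a : Fin (d + 1) → ℚ} (ha : IsEhrhartExpansion G d a)
    {T : Finset (Finset (E ⊕ V → ℝ))} (hT : IsTriangulation (rootPolytope G) T)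
    {x : ℚ} (hx : x ≠ 0) :
    x ^ (d + 1) * (hVector T).eval x⁻¹ = ∑ k : Fin (d + 1), a k * x ^ (k : ℕ) := by
  rw [pow_mul_eval_hVector T (hT.complexDim_eq hbip hconn hd) hx]
  have h1 := mk_mul_one_sub_pow_of_faces (f := fun s => (ehrhart G s : ℚ)) (d := d)
    (fun k => (faceCount T k : ℚ))
    (by rw [ehrhart_zero (edgeVectors_nonempty hbip hconn hd), Nat.cast_one])
    (fun s => by rw [hT.ehrhart_succ_eq hbip hconn hd]; push_cast; rfl)
  have h2 := (expansion_iff (fun s => (ehrhart G s : ℚ)) d a).1 ha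
  -- Both polynomials are the numerator of the Ehrhart series over $(1-X)^{d+1}$; in particular the
  -- coefficient of $X^{d+1}$ on the face side vanishes.
  rw [Polynomial.coe_injective ℚ (h1.symm.trans h2)]
  simp [Polynomial.eval_finsetSum]

theorem hVector_eq_of_isTriangulation (hbip : G ≤ completeBipartiteGraph E V)
    (hconn : G.Connected) {d : ℕ} (hd : Fintype.card E + Fintype.card V = d + 2)
    {T₁ T₂ : Finset (Finset (E ⊕ V → ℝ))} (hT₁ : IsTriangulation (rootPolytope G) T₁)
    (hT₂ : IsTriangulation (rootPolytope G) T₂) : hVector T₁ = hVector T₂ := by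
  obtain ⟨a, ha⟩ := exists_isEhrhartExpansion (edgeVectors_nonempty hbip hconn hd) hd
  -- The formula at `x = y⁻¹` determines the value of an h-vector at every nonzero `y`.
  refine Polynomial.eq_of_infinite_eval_eq _ _
    ((Set.finite_singleton (0 : ℚ)).infinite_compl.mono fun y hy => ?_)
  have hy : y⁻¹ ≠ 0 := inv_ne_zero hy
  have h := (hT₁.pow_mul_eval_hVector_eq hbip hconn hd ha hy).trans
    (hT₂.pow_mul_eval_hVector_eq hbip hconn hd ha hy).symm
  rw [inv_inv] at h
  exact mul_left_cancel₀ (pow_ne_zero _ hy) h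

end HVector

end RootPolytope

theorem theorem3p6 {E V : Type*} [Fintype E] [Fintype V] [DecidableEq E] [DecidableEq V]
    (G : SimpleGraph (E ⊕ V)) (hbip : G ≤ completeBipartiteGraph E V) (hconn : G.Connected)
    (d : ℕ) (hd : Fintype.card E + Fintype.card V = d + 2) :
    (∃! a : Fin (d + 1) → ℚ, RootPolytope.IsEhrhartExpansion G d a) ∧
    (∀ a : Fin (d + 1) → ℚ, RootPolytope.IsEhrhartExpansion G d a →
      ∀ T : Finset (Finset (E ⊕ V → ℝ)),
        RootPolytope.IsTriangulation (RootPolytope.rootPolytope G) T →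
        ∀ x : ℚ, x ≠ 0 →
          x ^ (d + 1) * (RootPolytope.hVector T).eval x⁻¹ =
            ∑ k : Fin (d + 1), a k * x ^ (k : ℕ)) ∧
    (∀ T₁ T₂ : Finset (Finset (E ⊕ V → ℝ)),
      RootPolytope.IsTriangulation (RootPolytope.rootPolytope G) T₁ →
      RootPolytope.IsTriangulation (RootPolytope.rootPolytope G) T₂ →
      RootPolytope.hVector T₁ = RootPolytope.hVector T₂) := by
  refine ⟨?_, fun a ha T hT x hx => hT.pow_mul_eval_hVector_eq hbip hconn hd ha hx,
    fun T₁ T₂ hT₁ hT₂ => RootPolytope.hVector_eq_of_isTriangulation hbip hconn hd hT₁ hT₂⟩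
  obtain ⟨a, ha⟩ := RootPolytope.exists_isEhrhartExpansion
    (RootPolytope.edgeVectors_nonempty hbip hconn hd) hd
  exact ⟨a, ha, fun b hb => RootPolytope.expansion_unique hb ha⟩
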